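/- Theorem 3.6 (nonzero c.e. degree, computable $r$). For $X\subseteq\mathbb N$ let $\underline\rho(X)=\liminf_{n\to\infty}|X\cap\{0,\dots,n-1\}|/n$ be its lower density. For $r\in[0,1]$, a set $A\subseteq\mathbb N$ is partially computable at density $r$ if there is a partial computable function $\varphi$ that agrees with the characteristic function of $A$ on its domain, with $\underline\rho(\operatorname{dom}\varphi)\ge r$; and $A$ is coarsely computable at density $r$ if there is a computable set $C$ with $\underline\rho(\{n : n\in A\Leftrightarrow n\in C\})\ge r$. Let $\alpha(A)$ and $\gamma(A)$ be the suprema of those $r\in[0,1]$ such that $A$ is partially computable at density $r$, respectively coarsely computable at density $r$. Let $\mathbf a$ be a nonzero c.e. Turing degree, that is, the Turing degree of a noncomputable c.e. set, and let $r\in(0,1]$ be a computable real. Then there is a c.e. set $A$ of degree $\mathbf a$ such that $\alpha(A)=\gamma(A)=r$ and $A$ is not coarsely computable at density $r$. -/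

import Mathlib

namespace CoarseComp

/-- The characteristic function of a set of natural numbers. -/
noncomputable def charFn (A : Set ℕ) : ℕ → ℕ := A.indicator (fun _ => 1)

/-- The density of `A` below `n`, that is `|A ∩ {0, …, n-1}| / n` (used for `n ≥ 1`). -/
noncomputable def densityBelow (A : Set ℕ) (n : ℕ) : ℝ :=
  ((A ∩ Set.Iio n).ncard : ℝ) / (n : ℝ)

/-- The lower (asymptotic) density of `A`. -/
noncomputable def lowerDensity (A : Set ℕ) : ℝ :=
  Filter.liminf (densityBelow A) Filter.atTop

/-- The set where `A` and `B` agree. -/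
def agreement (A B : Set ℕ) : Set ℕ := {n | n ∈ A ↔ n ∈ B}

/-- `A` is partially computable at density `r`: some partial computable function agrees with the
characteristic function of `A` wherever it is defined, and its domain has lower density at
least `r`. -/
def PartiallyComputableAt (A : Set ℕ) (r : ℝ) : Prop :=
  ∃ φ : ℕ →. ℕ, Partrec φ ∧ (∀ n, ∀ v ∈ φ n, v = charFn A n) ∧ r ≤ lowerDensity φ.Dom

/-- `A` is coarsely computable at density `r`: some computable set agrees with `A` on a set of
lower density at least `r`. -/
def CoarselyComputableAt (A : Set ℕ) (r : ℝ) : Prop :=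
  ∃ C : Set ℕ, ComputablePred (fun n => n ∈ C) ∧ r ≤ lowerDensity (agreement A C)

/-- The partial computability bound `α(A)`. -/
noncomputable def partialBound (A : Set ℕ) : ℝ :=
  sSup {r : ℝ | r ∈ Set.Icc (0 : ℝ) 1 ∧ PartiallyComputableAt A r}

/-- The coarse computability bound `γ(A)`. -/
noncomputable def coarseBound (A : Set ℕ) : ℝ :=
  sSup {r : ℝ | r ∈ Set.Icc (0 : ℝ) 1 ∧ CoarselyComputableAt A r}

/-- The Turing degree of a set of natural numbers. -/
noncomputable def degree (A : Set ℕ) : TuringDegree :=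
  toAntisymmetrization TuringReducible (fun n => Part.some (charFn A n))

/-- The degree `0`, that is the degree of the computable sets. -/
noncomputable def zeroDegree : TuringDegree := degree ∅

/-- A c.e. degree is the degree of a computably enumerable set. -/
def IsCEDegree (a : TuringDegree) : Prop :=
  ∃ B : Set ℕ, REPred (fun n => n ∈ B) ∧ degree B = a

/-- A real is computable if it is the limit of a computable sequence of rationals
`(-1) ^ s k * p k / q k` with error at most `2⁻ᵏ` at place `k`. -/
def IsComputableReal (x : ℝ) : Prop :=
  ∃ s p q : ℕ → ℕ, Computable s ∧ Computable p ∧ Computable q ∧ (∀ k, q k ≠ 0) ∧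
    ∀ k, |(-1 : ℝ) ^ s k * (p k : ℝ) / (q k : ℝ) - x| ≤ (1 / 2 : ℝ) ^ k

end CoarseComp

/-!
Let `b` be an injective computable enumeration of a set of degree `a`. The constructed set `A` codes
`range b` on the squares, which have density zero. Reserve computable sets `D 0 ⊆ D 1 ⊆ ⋯` whose
densities increase to `r`, and cut `ℕ` into blocks, each much longer than all that precedes it.
Block `⟨e, m⟩` belongs to the requirement `e`, which may put numbers outside `D e` and the squares
into `A`, and only at the stage `s` with `b s = m`, so that `A` is computable from `range b`. Since
`range b` is not computable, requirement `e` is infinitely often permitted to act after its partial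
computable strategy has converged, or the strategy diverges infinitely often. In both cases a given
partial or total computable function is defeated on infinitely many blocks outside `D e`, which
keeps the density below that of `D e`, hence below `r`. On the other hand only the requirements
below `k` act in `D k`, and each acts computably if it waits for records, so that `A ∩ D k` is
computable and both bounds are at least `r`.
-/

namespace CoarseComp

open Filter Topology
open Nat.Partrec (Code)

/-! ### Computable predicates -/

section ComputablePred

variable {α β : Type*} [Primcodable α] [Primcodable β]

theorem computablePred_comp {p : β → Prop} {f : α → β} (hp : ComputablePred p)
    (hf : Computable f) : ComputablePred fun a => p (f a) :=
  hp.computable_of_manyOneReducible ⟨f, hf, fun _ => Iff.rfl⟩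

theorem computablePred_and {p q : α → Prop} (hp : ComputablePred p) (hq : ComputablePred q) :
    ComputablePred fun a => p a ∧ q a := by
  obtain ⟨f, hf, rfl⟩ := ComputablePred.computable_iff.1 hp
  obtain ⟨g, hg, rfl⟩ := ComputablePred.computable_iff.1 hq
  exact ComputablePred.computable_iff.2 ⟨_, Primrec.and.to_comp.comp hf hg, by simp⟩

theorem computablePred_or {p q : α → Prop} (hp : ComputablePred p) (hq : ComputablePred q) :
    ComputablePred fun a => p a ∨ q a :=
  (computablePred_and hp.not hq.not).not.of_eq fun a => by tauto

theorem computablePred_const (p : Prop) : ComputablePred fun _ : α => p := by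
  classical
  exact ComputablePred.computable_iff.2 ⟨fun _ => decide p, Computable.const _, by simp⟩

theorem computablePred_eq {f g : α → β} (hf : Computable f) (hg : Computable g) :
    ComputablePred fun a => f a = g a :=
  computablePred_comp
    (PrimrecPred.computablePred (p := fun x : β × β => x.1 = x.2) Primrec.eq) (hf.pair hg)

theorem computablePred_le {f g : α → ℕ} (hf : Computable f) (hg : Computable g) :
    ComputablePred fun a => f a ≤ g a :=
  computablePred_comp
    (PrimrecPred.computablePred (p := fun x : ℕ × ℕ => x.1 ≤ x.2) Primrec.nat_le) (hf.pair hg)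

theorem computablePred_lt {f g : α → ℕ} (hf : Computable f) (hg : Computable g) :
    ComputablePred fun a => f a < g a :=
  (computablePred_le hg hf).not.of_eq fun _ => not_le

theorem computablePred_isSome {f : α → Option β} (hf : Computable f) :
    ComputablePred fun a => (f a).isSome :=
  computablePred_eq (Primrec.option_isSome.to_comp.comp hf) (Computable.const true)

theorem computablePred_list_mem {f : α → β} {l : α → List β} (hf : Computable f)
    (hl : Computable l) : ComputablePred fun a => f a ∈ l a := by
  classical
  exact (computablePred_lt (Primrec.list_idxOf.to_comp.comp hf hl)
    (Computable.list_length.comp hl)).of_eq fun _ => List.idxOf_lt_length_iff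

theorem computablePred_exists_lt {R : α → ℕ → Prop}
    (hR : ComputablePred fun p : α × ℕ => R p.1 p.2) {f : α → ℕ} (hf : Computable f) :
    ComputablePred fun a => ∃ x < f a, R a x := by
  obtain ⟨g, hg, hgR⟩ := ComputablePred.computable_iff.1 hR
  have hgR' : ∀ a x, R a x ↔ g (a, x) = true := fun a x => iff_of_eq (congrFun hgR (a, x))
  have hstep : Computable₂ fun (a : α) (p : ℕ × Bool) => p.2 || g (a, p.1) :=
    (Primrec.or.to_comp.comp (Computable.snd.comp Computable.snd)
      (hg.comp (Computable.fst.pair (Computable.fst.comp Computable.snd))) :)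
  refine ComputablePred.computable_iff.2
    ⟨_, Computable.nat_rec hf (Computable.const false) hstep, funext fun a => propext ?_⟩
  induction f a with
  | zero => simp
  | succ n ih =>
    rw [Nat.exists_lt_succ_right, ih, hgR']
    simp

theorem computablePred_forall_lt {R : α → ℕ → Prop}
    (hR : ComputablePred fun p : α × ℕ => R p.1 p.2) {f : α → ℕ} (hf : Computable f) :
    ComputablePred fun a => ∀ x < f a, R a x :=
  (computablePred_exists_lt (R := fun a x => ¬ R a x) hR.not hf).not.of_eq fun a => by
    push Not; rfl

theorem computablePred_lt_and {g : α → ℕ} {p : α → Prop}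
    (h : ∀ e, ComputablePred fun a => g a = e ∧ p a) (k : ℕ) :
    ComputablePred fun a => g a < k ∧ p a := by
  induction k with
  | zero => simpa using computablePred_const False
  | succ k ih =>
    refine (computablePred_or ih (h k)).of_eq fun a => ?_
    rw [Nat.lt_succ_iff_lt_or_eq, or_and_right]

theorem computable_ite {p : α → Prop} [DecidablePred p] {f g : α → β} (hp : ComputablePred p)
    (hf : Computable f) (hg : Computable g) : Computable fun a => if p a then f a else g a :=
  (Computable.cond hp.decide hf hg).of_eq fun _ => Bool.cond_decide ..

theorem rePred_exists {R : α → ℕ → Prop} (hR : ComputablePred fun p : α × ℕ => R p.1 p.2) :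
    REPred fun a => ∃ s, R a s := by
  classical
  have hsearch : Partrec fun a => Nat.rfind fun s => Part.some (decide (R a s)) :=
    Partrec.rfind hR.decide.partrec
  exact hsearch.dom_re.of_eq fun a => Nat.rfind_dom.trans (by simp)

theorem computable_table {f : α → ℕ → β} (hf : Computable₂ f) {k : α → ℕ} (hk : Computable k) :
    Computable fun a => (List.range (k a)).map (f a) := by
  have hstep : Computable₂ fun (a : α) (p : ℕ × List β) => p.2 ++ [f a p.1] :=
    (Computable.list_concat.comp (Computable.snd.comp Computable.snd)
      (hf.comp Computable.fst (Computable.fst.comp Computable.snd)) :)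
  refine (Computable.nat_rec hk (Computable.const []) hstep).of_eq fun a => ?_
  induction k a with
  | zero => rfl
  | succ n ih => simp [List.range_succ, ih]

theorem computablePred_of_finite {p : ℕ → Prop} (hp : {n | p n}.Finite) : ComputablePred p :=
  (computablePred_list_mem Computable.id (Computable.const hp.toFinset.toList)).of_eq
    fun n => by simp

theorem computablePred_of_eventually_iff {p q : ℕ → Prop} (hq : ComputablePred q)
    (h : ∀ᶠ n in atTop, p n ↔ q n) : ComputablePred p := by
  obtain ⟨N, hN⟩ := eventually_atTop.1 h
  have hlow : ComputablePred fun n => n < N ∧ p n :=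
    computablePred_of_finite ((Set.finite_lt_nat N).subset fun n hn => hn.1)
  refine (computablePred_or hlow
    (computablePred_and (computablePred_le (Computable.const N) Computable.id) hq)).of_eq
    fun n => ?_
  rcases lt_or_ge n N with hn | hn
  · simp [hn, hn.not_ge]
  · simp [hn, hn.not_gt, hN n hn]

end ComputablePred

/-! ### Enumerations -/

/-- The stage `s` approximation, with values in `σ`, to the `e`-th partial computable function:
the value at `n`, if it is found within `s` steps. -/
def approx (σ : Type*) [Primcodable σ] (e n s : ℕ) : Option σ :=
  (Code.evaln s (Denumerable.ofNat Code e) n).bind Encodable.decode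

section approx

variable {α σ : Type*} [Primcodable α] [Primcodable σ]

theorem computable_approx {e n s : α → ℕ} (he : Computable e) (hn : Computable n)
    (hs : Computable s) : Computable fun a => approx σ (e a) (n a) (s a) :=
  Computable.option_bind
    (Code.primrec_evaln.to_comp.comp ((hs.pair ((Computable.ofNat Code).comp he)).pair hn))
    (Computable.decode.comp Computable.snd : Computable₂ fun _ v => Encodable.decode v)

theorem approx_mono {e n s t : ℕ} {v : σ} (hst : s ≤ t) (h : v ∈ approx σ e n s) :
    v ∈ approx σ e n t := by
  obtain ⟨w, hw, hwv⟩ := Option.bind_eq_some_iff.1 h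
  exact Option.bind_eq_some_iff.2 ⟨w, Code.evaln_mono hst hw, hwv⟩

theorem exists_index {Φ : ℕ →. σ} (hΦ : Partrec Φ) :
    ∃ e, ∀ n v, v ∈ Φ n ↔ ∃ s, v ∈ approx σ e n s := by
  obtain ⟨c, hc⟩ := Code.exists_code.1 (Partrec.nat_iff.1 (Partrec.map_encode_iff.2 hΦ))
  have hcode : ∀ n w, (∃ s, w ∈ Code.evaln s c n) ↔ ∃ v ∈ Φ n, Encodable.encode v = w := by
    intro n w
    rw [← Code.evaln_complete, hc]
    simp
  refine ⟨Encodable.encode c, fun n v => ⟨fun hv => ?_, ?_⟩⟩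
  · obtain ⟨s, hs⟩ := (hcode n _).2 ⟨v, hv, rfl⟩
    refine ⟨s, Option.bind_eq_some_iff.2 ⟨_, ?_, Encodable.encodek v⟩⟩
    rwa [Denumerable.ofNat_encode]
  · rintro ⟨s, hs⟩
    obtain ⟨w, hw, hwv⟩ := Option.bind_eq_some_iff.1 hs
    rw [Denumerable.ofNat_encode] at hw
    obtain ⟨u, hu, rfl⟩ := (hcode n w).1 ⟨s, hw⟩
    rw [Encodable.encodek] at hwv
    rwa [← Option.some_injective _ hwv]

end approx

theorem exists_computable_range_eq {B : Set ℕ} (hB : REPred (· ∈ B)) (hne : B.Nonempty) :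
    ∃ b : ℕ → ℕ, Computable b ∧ Set.range b = B := by
  obtain ⟨n₀, hn₀⟩ := hne
  obtain ⟨e, he⟩ := exists_index hB
  have hdom : ∀ n, n ∈ B ↔ ∃ s, (approx Unit e n s).isSome := fun n => by
    simpa [Option.isSome_iff_exists, Unique.exists_iff] using he n ()
  have hfst : Computable fun s : ℕ => s.unpair.1 := Computable.fst.comp Computable.unpair
  have hfound : ComputablePred fun s : ℕ => (approx Unit e s.unpair.1 s.unpair.2).isSome :=
    computablePred_isSome (computable_approx (Computable.const e) hfst
      (Computable.snd.comp Computable.unpair))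
  refine ⟨_, ComputablePred.ite hfst (Computable.const n₀) hfound, Set.Subset.antisymm ?_ ?_⟩
  · rintro _ ⟨s, rfl⟩
    dsimp only
    split_ifs with h
    · exact (hdom _).2 ⟨_, h⟩
    · exact hn₀
  · intro n hn
    obtain ⟨s, hs⟩ := (hdom n).1 hn
    exact ⟨Nat.pair n s, by simp [hs]⟩

theorem computable_count {p : ℕ → Prop} [DecidablePred p] (hp : ComputablePred p) :
    Computable (Nat.count p) := by
  have hbit : Computable fun k => if p k then 1 else 0 :=
    ComputablePred.ite (Computable.const 1) (Computable.const 0) hp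
  have hstep : Computable₂ fun (_ : ℕ) (q : ℕ × ℕ) => q.2 + if p q.1 then 1 else 0 :=
    Primrec.nat_add.to_comp.comp (α := ℕ × ℕ × ℕ) (Computable.snd.comp Computable.snd)
      (hbit.comp (Computable.fst.comp Computable.snd))
  refine (Computable.nat_rec Computable.id (Computable.const 0) hstep).of_eq fun n => ?_
  induction n with
  | zero => simp
  | succ n ih => exact (congrArg (· + _) ih).trans (Nat.count_succ p n).symm

theorem computable_nth {p : ℕ → Prop} (hp : ComputablePred p) (hinf : {n | p n}.Infinite) :
    Computable (Nat.nth p) := by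
  classical
  have hex : ∀ n, ∃ s, p s ∧ Nat.count p s = n := fun n =>
    ⟨Nat.nth p n, Nat.nth_mem_of_infinite hinf n, Nat.count_nth_of_infinite hinf n⟩
  refine (Computable.find (P := fun n s => p s ∧ Nat.count p s = n)
    (computablePred_and (computablePred_comp hp Computable.snd)
      (computablePred_eq ((computable_count hp).comp Computable.snd) Computable.fst)) hex).of_eq
    fun n => ?_
  obtain ⟨hs, hn⟩ := Nat.find_spec (hex n)
  rw [← Nat.nth_count hs, hn]

theorem exists_injective_computable_range_eq {B : Set ℕ} (hB : REPred (· ∈ B))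
    (hinf : B.Infinite) :
    ∃ b : ℕ → ℕ, Computable b ∧ b.Injective ∧ Set.range b = B := by
  obtain ⟨b, hb, rfl⟩ := exists_computable_range_eq hB hinf.nonempty
  let Fresh s := ∀ t < s, b t ≠ b s
  have hfresh : ComputablePred Fresh := computablePred_forall_lt (R := fun s t => b t ≠ b s)
    (computablePred_eq (hb.comp Computable.snd) (hb.comp Computable.fst)).not Computable.id
  have hinj : Set.InjOn b {s | Fresh s} := fun s hs t ht hst =>
    le_antisymm (not_lt.1 fun h => hs t h hst.symm) (not_lt.1 fun h => ht s h hst)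
  have himage : b '' {s | Fresh s} = Set.range b := by
    refine Set.Subset.antisymm (Set.image_subset_range _ _) ?_
    rintro _ ⟨s, rfl⟩
    have hex : ∃ t, b t = b s := ⟨s, rfl⟩
    refine ⟨Nat.find hex, fun t ht htb => Nat.find_min hex ht ?_, Nat.find_spec hex⟩
    exact htb.trans (Nat.find_spec hex)
  have hFinf : {s | Fresh s}.Infinite := Set.Infinite.of_image b (himage ▸ hinf)
  refine ⟨b ∘ Nat.nth Fresh, hb.comp (computable_nth hfresh hFinf), fun m n hmn => ?_, ?_⟩
  · exact Nat.nth_injective hFinf (hinj (Nat.nth_mem_of_infinite hFinf m)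
      (Nat.nth_mem_of_infinite hFinf n) hmn)
  · rw [Set.range_comp, Nat.range_nth_of_infinite hFinf, himage]

/-! ### Turing reducibility -/

/-- `A` is Turing reducible to `B`, as sets of natural numbers. -/
def SetReducible (A B : Set ℕ) : Prop :=
  TuringReducible (fun n => Part.some (charFn A n)) (fun n => Part.some (charFn B n))

section charFn

variable {A B : Set ℕ}

theorem charFn_of_mem {n : ℕ} (h : n ∈ A) : charFn A n = 1 := by simp [charFn, h]

theorem charFn_of_notMem {n : ℕ} (h : n ∉ A) : charFn A n = 0 := by simp [charFn, h]

theorem charFn_eq_charFn {m n : ℕ} (h : m ∈ A ↔ n ∈ B) : charFn A m = charFn B n := by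
  by_cases hn : n ∈ B
  · rw [charFn_of_mem hn, charFn_of_mem (h.2 hn)]
  · rw [charFn_of_notMem hn, charFn_of_notMem (mt h.1 hn)]

theorem computable_charFn (hA : ComputablePred (· ∈ A)) : Computable (charFn A) := by
  classical
  exact (ComputablePred.ite (Computable.const 1) (Computable.const 0) hA).of_eq fun n => by
    simp [charFn, Set.indicator_apply]

theorem setReducible_of_computablePred (hA : ComputablePred (· ∈ A)) : SetReducible A B :=
  Partrec.turingReducible (computable_charFn hA)

theorem degree_eq_of_setReducible (hAB : SetReducible A B) (hBA : SetReducible B A) :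
    degree A = degree B :=
  Quotient.sound ⟨hAB, hBA⟩

theorem degree_eq_zeroDegree (hA : ComputablePred (· ∈ A)) : degree A = zeroDegree :=
  degree_eq_of_setReducible (setReducible_of_computablePred hA)
    (setReducible_of_computablePred (by simpa using computablePred_const (α := ℕ) False))

theorem setReducible_of_query {q : ℕ → ℕ} (hq : Computable q) {G : ℕ × ℕ →. ℕ} (hG : Partrec G)
    (h : ∀ x, charFn A x ∈ G (charFn B (q x), x)) : SetReducible A B := by
  refine RecursiveIn.iff_nat.2 ?_
  set O : Set (ℕ →. ℕ) := {fun n => Part.some (charFn B n)}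
  have hq' : Nat.RecursiveIn O fun n => Part.some (q n) :=
    (Partrec.nat_iff.1 hq).recursiveIn
  have hid : Nat.RecursiveIn O fun n => Part.some n :=
    (Partrec.nat_iff.1 Computable.id).recursiveIn
  have hB : Nat.RecursiveIn O fun n => Part.some (charFn B (q n)) :=
    (Nat.RecursiveIn.comp (.oracle _ (Set.mem_singleton _)) hq').of_eq fun n => by simp
  have hG' : Nat.RecursiveIn O fun n => G n.unpair :=
    (Partrec.nat_iff.1 (hG.comp Computable.unpair)).recursiveIn
  refine (Nat.RecursiveIn.comp hG' (hB.pair hid)).of_eq fun x => ?_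
  rw [Part.eq_some_iff]
  simpa [Seq.seq] using h x

theorem setReducible_of_manyOne {q : ℕ → ℕ} (hq : Computable q) (h : ∀ x, x ∈ A ↔ q x ∈ B) :
    SetReducible A B :=
  setReducible_of_query hq (G := fun p => Part.some p.1) Computable.fst fun x =>
    Part.mem_some_iff.2 (charFn_eq_charFn (h x))

end charFn

/-- If `q x` is enumerated at all, then its unique stage can be found and decides `x ∈ A`. -/
theorem setReducible_range_of_stage {b : ℕ → ℕ} (hb : Computable b) (hinj : b.Injective)
    {q : ℕ → ℕ} (hq : Computable q) {P : ℕ → ℕ → Prop}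
    (hP : ComputablePred fun p : ℕ × ℕ => P p.1 p.2) {A : Set ℕ}
    (hA : ∀ x, x ∈ A ↔ ∃ s, b s = q x ∧ P x s) : SetReducible A (Set.range b) := by
  classical
  let stage x := Nat.rfind fun s => Part.some (decide (b s = q x))
  have hstage : Partrec stage := Partrec.rfind
    (computablePred_eq (α := ℕ × ℕ) (hb.comp Computable.snd)
      (hq.comp Computable.fst)).decide.partrec
  have hbit : Computable fun p : ℕ × ℕ => if P p.1 p.2 then 1 else 0 :=
    computable_ite hP (Computable.const 1) (Computable.const 0)
  have hverdict : Computable₂ fun (p : ℕ × ℕ) s => if P p.2 s then 1 else 0 :=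
    hbit.comp (α := (ℕ × ℕ) × ℕ) ((Computable.snd.comp Computable.fst).pair Computable.snd)
  have hG : Partrec fun p : ℕ × ℕ => cond (decide (p.1 = 0)) (Part.some 0)
      ((stage p.2).map fun s => if P p.2 s then 1 else 0) :=
    Partrec.cond (computablePred_eq Computable.fst (Computable.const 0)).decide
      (Computable.const 0) ((hstage.comp Computable.snd).map hverdict)
  refine setReducible_of_query hq hG fun x => ?_
  by_cases hx : q x ∈ Set.range b
  · have ⟨s, hs⟩ := hx
    have hmem : s ∈ stage x := Nat.mem_rfind.2
      ⟨by simp [hs], fun {t} ht => by simpa [← hs] using hinj.ne ht.ne⟩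
    have hxA : x ∈ A ↔ P x s := (hA x).trans
      ⟨fun ⟨t, ht, hPt⟩ => hinj (ht.trans hs.symm) ▸ hPt, fun h => ⟨s, hs, h⟩⟩
    rw [charFn_of_mem hx]
    refine (Part.mem_map_iff _).2 ⟨s, hmem, ?_⟩
    simp [charFn, Set.indicator_apply, hxA]
  · rw [charFn_of_notMem hx, charFn_of_notMem fun h => ?_]
    · simp
    · obtain ⟨s, hs, -⟩ := (hA x).1 h
      exact hx ⟨s, hs⟩

/-! ### Density -/

/-- `X` has asymptotic density `ρ`. -/
def HasDensity (X : Set ℕ) (ρ : ℝ) : Prop :=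
  Tendsto (densityBelow X) atTop (𝓝 ρ)

section Density

variable {X Y : Set ℕ}

theorem densityBelow_eq_count (X : Set ℕ) [DecidablePred (· ∈ X)] (n : ℕ) :
    densityBelow X n = Nat.count (· ∈ X) n / n := by
  rw [densityBelow, Nat.count_eq_card_filter_range, ← Set.ncard_coe_finset]
  congr 3
  ext x
  simp [and_comm]

theorem densityBelow_nonneg (X : Set ℕ) (n : ℕ) : 0 ≤ densityBelow X n := by
  unfold densityBelow; positivity

theorem densityBelow_le_add {M N : ℕ} (h : ∀ x ∈ X, M ≤ x → x < N → x ∈ Y) :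
    densityBelow X N ≤ densityBelow Y N + (M : ℝ) / N := by
  have hsub : X ∩ Set.Iio N ⊆ (Y ∩ Set.Iio N) ∪ Set.Iio M := fun x ⟨hx, hxN⟩ => by
    rcases lt_or_ge x M with hxM | hxM
    · exact .inr hxM
    · exact .inl ⟨h x hx hxM hxN, hxN⟩
  have hcard : (X ∩ Set.Iio N).ncard ≤ (Y ∩ Set.Iio N).ncard + M :=
    (Set.ncard_le_ncard hsub (((Set.finite_Iio N).inter_of_right _).union
      (Set.finite_Iio M))).trans
      ((Set.ncard_union_le _ _).trans_eq (by rw [Set.ncard_Iio_nat]))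
  rw [densityBelow, densityBelow, ← add_div]
  gcongr
  exact_mod_cast hcard

theorem densityBelow_mono (h : X ⊆ Y) (n : ℕ) : densityBelow X n ≤ densityBelow Y n := by
  simpa using densityBelow_le_add (M := 0) (N := n) fun x hx _ _ => h hx

theorem densityBelow_le_one (X : Set ℕ) (n : ℕ) : densityBelow X n ≤ 1 := by
  have hempty : densityBelow (∅ : Set ℕ) n = 0 := by simp [densityBelow]
  have h := densityBelow_le_add (X := X) (Y := ∅) (M := n) (N := n) fun x _ h h' =>
    absurd h' h.not_gt
  rw [hempty, zero_add] at h
  exact h.trans (div_self_le_one _)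

theorem densityBelow_union_le (X Y : Set ℕ) (n : ℕ) :
    densityBelow (X ∪ Y) n ≤ densityBelow X n + densityBelow Y n := by
  rw [densityBelow, densityBelow, densityBelow, ← add_div, Set.union_inter_distrib_right]
  gcongr
  exact_mod_cast Set.ncard_union_le _ _

theorem isBoundedUnder_ge_densityBelow (X : Set ℕ) (l : Filter ℕ) :
    l.IsBoundedUnder (· ≥ ·) (densityBelow X) :=
  isBoundedUnder_of ⟨0, densityBelow_nonneg X⟩

theorem isBoundedUnder_le_densityBelow (X : Set ℕ) (l : Filter ℕ) :
    l.IsBoundedUnder (· ≤ ·) (densityBelow X) :=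
  isBoundedUnder_of ⟨1, densityBelow_le_one X⟩

theorem lowerDensity_mono (h : X ⊆ Y) : lowerDensity X ≤ lowerDensity Y :=
  liminf_le_liminf (.of_forall (densityBelow_mono h)) (isBoundedUnder_ge_densityBelow X _)
    (isBoundedUnder_le_densityBelow Y _).isCoboundedUnder_ge

theorem lowerDensity_le_of_frequently_le {u : ℕ → ℕ} (hu : Tendsto u atTop atTop) {f : ℕ → ℝ}
    {c : ℝ} (hf : Tendsto f atTop (𝓝 c)) (h : ∃ᶠ n in atTop, densityBelow X (u n) ≤ f n) :
    lowerDensity X ≤ c := by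
  refine le_of_forall_gt_imp_ge_of_dense fun w hw => ?_
  refine liminf_le_of_frequently_le (hu.frequently ?_) (isBoundedUnder_ge_densityBelow X _)
  exact (h.and_eventually (hf.eventually_lt_const hw)).mono fun n hn => (hn.1.trans_lt hn.2).le

theorem HasDensity.lowerDensity_eq {ρ : ℝ} (h : HasDensity X ρ) : lowerDensity X = ρ :=
  h.liminf_eq

theorem HasDensity.nonneg {ρ : ℝ} (h : HasDensity X ρ) : 0 ≤ ρ :=
  ge_of_tendsto' h (densityBelow_nonneg X)

theorem HasDensity.le_one {ρ : ℝ} (h : HasDensity X ρ) : ρ ≤ 1 :=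
  le_of_tendsto' h (densityBelow_le_one X)

/-! ### Columns between consecutive squares -/

/-- The distance from `x` to the largest square below it, so that `[j * j, (j + 1) * (j + 1))` is
cut out by `Nat.sqrt x = j` and is coordinatized by `offset x ≤ 2 * j`. The squares are the
numbers of offset `0`. -/
def offset (x : ℕ) : ℕ := x - x.sqrt * x.sqrt

theorem computable_offset : Computable offset :=
  (Primrec.nat_sub.comp Primrec.id (Primrec.nat_mul.comp Primrec.nat_sqrt
    Primrec.nat_sqrt)).to_comp

theorem sqrt_mul_self_add {j i : ℕ} (hi : i ≤ 2 * j) : (j * j + i).sqrt = j :=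
  Nat.sqrt_add_eq j (by omega)

theorem offset_mul_self_add {j i : ℕ} (hi : i ≤ 2 * j) : offset (j * j + i) = i := by
  rw [offset, sqrt_mul_self_add hi]
  omega

theorem count_column (P : ℕ → ℕ → Prop) [∀ j, DecidablePred (P j)] {j k : ℕ} (hk : k ≤ 2 * j + 1) :
    Nat.count (fun x => P x.sqrt (offset x)) (j * j + k) =
      Nat.count (fun x => P x.sqrt (offset x)) (j * j) + Nat.count (P j) k := by
  rw [Nat.count_add, add_right_inj, Nat.count_eq_card_filter_range,
    Nat.count_eq_card_filter_range]
  congr 1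
  refine Finset.filter_congr fun i hi => ?_
  have : i ≤ 2 * j := by have := Finset.mem_range.1 hi; omega
  rw [sqrt_mul_self_add this, offset_mul_self_add this]

theorem abs_count_mul_self_sub_le {P : ℕ → ℕ → Prop} [∀ j, DecidablePred (P j)] {ρ : ℝ}
    (h : ∀ j : ℕ, |(Nat.count (P j) (2 * j + 1) : ℝ) - ρ * (2 * j + 1)| ≤ 1) (j : ℕ) :
    |(Nat.count (fun x => P x.sqrt (offset x)) (j * j) : ℝ) - ρ * (j * j)| ≤ j := by
  induction j with
  | zero => simp
  | succ j ih =>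
    have hcol := count_column P (le_refl (2 * j + 1))
    rw [show (j + 1) * (j + 1) = j * j + (2 * j + 1) by ring, hcol]
    have := h j
    push_cast at *
    rw [abs_le] at *
    constructor <;> linarith

theorem tendsto_natSqrt_atTop : Tendsto Nat.sqrt atTop atTop :=
  tendsto_atTop.2 fun m => (eventually_ge_atTop (m * m)).mono fun _ => Nat.le_sqrt.2

theorem abs_count_sub_le {P : ℕ → ℕ → Prop} [∀ j, DecidablePred (P j)] {ρ : ℝ}
    (h0 : 0 ≤ ρ) (h1 : ρ ≤ 1)
    (h : ∀ j : ℕ, |(Nat.count (P j) (2 * j + 1) : ℝ) - ρ * (2 * j + 1)| ≤ 1) (n : ℕ) :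
    |(Nat.count (fun x => P x.sqrt (offset x)) n : ℝ) - ρ * n| ≤ 3 * n.sqrt := by
  obtain ⟨i, hi, hn⟩ : ∃ i ≤ 2 * n.sqrt, n = n.sqrt * n.sqrt + i :=
    ⟨n - n.sqrt * n.sqrt, by have := Nat.sqrt_le_add n; omega, by have := Nat.sqrt_le n; omega⟩
  have hsquare := abs_count_mul_self_sub_le h n.sqrt
  have hcol := count_column P (Nat.le_succ_of_le hi)
  have hle : Nat.count (P n.sqrt) i ≤ i := Nat.count_le _
  rw [← hn] at hcol
  have hn' : (n : ℝ) = n.sqrt * n.sqrt + i := by exact_mod_cast hn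
  have hi' : (i : ℝ) ≤ 2 * n.sqrt := by exact_mod_cast hi
  have hle' : (Nat.count (P n.sqrt) i : ℝ) ≤ i := by exact_mod_cast hle
  have hρi : ρ * i ≤ i := mul_le_of_le_one_left (Nat.cast_nonneg _) h1
  have hρi0 : 0 ≤ ρ * i := by positivity
  have hP0 : (0 : ℝ) ≤ Nat.count (P n.sqrt) i := Nat.cast_nonneg _
  rw [hcol, hn']
  push_cast
  rw [abs_le] at *
  constructor <;> linarith

theorem hasDensity_of_abs_count_sub_le [DecidablePred (· ∈ X)] {ρ K : ℝ}
    (h : ∀ n : ℕ, |(Nat.count (· ∈ X) n : ℝ) - ρ * n| ≤ K * n.sqrt) : HasDensity X ρ := by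
  have hvanish : Tendsto (fun n : ℕ => K / (n.sqrt : ℝ)) atTop (𝓝 0) :=
    tendsto_const_nhds.div_atTop (tendsto_natCast_atTop_atTop.comp tendsto_natSqrt_atTop)
  have hK : 0 ≤ K := by simpa using (abs_nonneg _).trans (h 1)
  refine tendsto_iff_norm_sub_tendsto_zero.2
    (squeeze_zero' (.of_forall fun _ => norm_nonneg _) ?_ hvanish)
  filter_upwards [eventually_gt_atTop 0] with n hn
  have hs : (0 : ℝ) < n.sqrt := Nat.cast_pos.2 (Nat.sqrt_pos.2 hn)
  have hsq : (n.sqrt * n.sqrt : ℝ) ≤ n := by exact_mod_cast Nat.sqrt_le n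
  have hn0 : (0 : ℝ) < n := Nat.cast_pos.2 hn
  calc ‖densityBelow X n - ρ‖
      = |(Nat.count (· ∈ X) n : ℝ) - ρ * n| / n := by
        rw [densityBelow_eq_count, Real.norm_eq_abs, ← abs_of_pos hn0, ← abs_div, abs_of_pos hn0,
          sub_div, mul_div_cancel_right₀ _ hn0.ne']
    _ ≤ K * n.sqrt / n := by gcongr; exact h n
    _ ≤ K / n.sqrt := by
        rw [div_le_div_iff₀ hn0 hs, mul_assoc]
        gcongr

theorem hasDensity_of_column_count {P : ℕ → ℕ → Prop} [∀ j, DecidablePred (P j)] {ρ : ℝ}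
    (h0 : 0 ≤ ρ) (h1 : ρ ≤ 1)
    (h : ∀ j : ℕ, |(Nat.count (P j) (2 * j + 1) : ℝ) - ρ * (2 * j + 1)| ≤ 1) :
    HasDensity {x | P x.sqrt (offset x)} ρ :=
  hasDensity_of_abs_count_sub_le (K := 3) (abs_count_sub_le h0 h1 h)

theorem hasDensity_offset_eq_zero : HasDensity {x | offset x = 0} 0 :=
  hasDensity_of_column_count (P := fun _ i => i = 0) le_rfl zero_le_one fun j => by
    simp [Nat.count_eq_card_filter_range, Finset.filter_eq']

/-- The set of density `ρ` that fills, up to rounding, the fraction `ρ` of each column, leaving out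
the squares. -/
def wedge (ρ : ℝ) : Set ℕ := {x | 0 < offset x ∧ (offset x : ℝ) < ρ * (2 * x.sqrt + 1)}

theorem wedge_mono : Monotone wedge := fun _ _ h _ hx => ⟨hx.1, hx.2.trans_le (by gcongr)⟩

theorem hasDensity_wedge {ρ : ℝ} (h0 : 0 ≤ ρ) (h1 : ρ ≤ 1) : HasDensity (wedge ρ) ρ := by
  classical
  refine hasDensity_of_column_count (P := fun j i => 0 < i ∧ (i : ℝ) < ρ * (2 * j + 1)) h0 h1
    fun j => ?_
  set y := ρ * (2 * j + 1)
  have hy0 : 0 ≤ y := by positivity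
  have hy1 : ⌈y⌉₊ ≤ 2 * j + 1 :=
    Nat.ceil_le.2 ((mul_le_of_le_one_left (by positivity) h1).trans_eq (by push_cast; rfl))
  have hcount : Nat.count (fun i : ℕ => 0 < i ∧ (i : ℝ) < y) (2 * j + 1) = ⌈y⌉₊ - 1 := by
    have hfilter : (Finset.range (2 * j + 1)).filter (fun i : ℕ => 0 < i ∧ (i : ℝ) < y) =
        Finset.Ioo 0 ⌈y⌉₊ := by
      ext i
      simp only [Finset.mem_filter, Finset.mem_range, Finset.mem_Ioo, Nat.lt_ceil,
        and_iff_right_iff_imp]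
      exact fun h => (Nat.lt_ceil.2 h.2).trans_le hy1
    rw [Nat.count_eq_card_filter_range, hfilter, Nat.card_Ioo, Nat.sub_zero]
  have hlow : y ≤ (⌈y⌉₊ - 1 : ℕ) + 1 := (Nat.le_ceil y).trans (by norm_cast; omega)
  have hhigh : ((⌈y⌉₊ - 1 : ℕ) : ℝ) ≤ y := by
    rcases Nat.eq_zero_or_pos ⌈y⌉₊ with h | h
    · simpa [h] using hy0
    · rw [Nat.cast_pred h]
      linarith [Nat.ceil_lt_add_one hy0]
  rw [hcount, abs_le]
  constructor <;> linarith

end Density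

/-! ### Approximating a real from below -/

/-- A positive real that is the supremum of a computable sequence of smaller nonnegative rationals
`p k / q k`, that is a positive left-c.e. real. -/
def IsLeftCEReal (r : ℝ) : Prop :=
  ∃ p q : ℕ → ℕ, Computable p ∧ Computable q ∧ (∀ k, 0 < q k) ∧ (∀ k, (p k : ℝ) / q k < r) ∧
    ∀ w < r, ∃ k, w < (p k : ℝ) / q k

theorem natSub_div_eq_max (m n d : ℕ) :
    ((m - n : ℕ) : ℝ) / d = max 0 (((m : ℝ) - n) / d) := by
  rcases le_total n m with h | h
  · have : (n : ℝ) ≤ m := Nat.cast_le.2 h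
    rw [Nat.cast_sub h, max_eq_right (div_nonneg (by linarith) d.cast_nonneg)]
  · have : (m : ℝ) ≤ n := Nat.cast_le.2 h
    rw [Nat.sub_eq_zero_of_le h, Nat.cast_zero, zero_div,
      max_eq_left (div_nonpos_of_nonpos_of_nonneg (by linarith) d.cast_nonneg)]

theorem computable_two_pow : Computable fun k : ℕ => 2 ^ k :=
  ((Primrec₂.unpaired'.1 Nat.Primrec.pow).comp (Primrec.const 2) Primrec.id).to_comp

theorem IsComputableReal.isLeftCEReal {r : ℝ} (hr : IsComputableReal r) (hr0 : 0 < r) :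
    IsLeftCEReal r := by
  obtain ⟨s, p, q, hs, hp, hq, hq0, happrox⟩ := hr
  let p' k := if s k % 2 = 0 then p k * 2 ^ k - 2 * q k else 0
  let q' k := 2 ^ k * q k
  have hvalue : ∀ k, (p' k : ℝ) / q' k =
      max 0 ((-1 : ℝ) ^ s k * p k / q k - 2 * (1 / 2) ^ k) := fun k => by
    have hqk : (q k : ℝ) ≠ 0 := Nat.cast_ne_zero.2 (hq0 k)
    rcases Nat.mod_two_eq_zero_or_one (s k) with h | h
    · simp only [p', q', if_pos h, natSub_div_eq_max, (Nat.even_iff.2 h).neg_one_pow, one_mul]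
      congr 1
      push_cast
      rw [one_div, inv_pow]
      field_simp
    · have : (0 : ℝ) ≤ p k / q k + 2 * (1 / 2) ^ k := by positivity
      simp only [p', h, one_ne_zero, if_false, Nat.cast_zero, zero_div,
        (Nat.odd_iff.2 h).neg_one_pow, neg_one_mul, neg_div]
      exact (max_eq_left (by linarith)).symm
  refine ⟨p', q', ?_, Primrec.nat_mul.to_comp.comp computable_two_pow hq,
    fun k => Nat.mul_pos (by positivity) (Nat.pos_of_ne_zero (hq0 k)), fun k => ?_, fun w hw => ?_⟩
  · exact ComputablePred.ite (Primrec.nat_sub.to_comp.comp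
      (Primrec.nat_mul.to_comp.comp hp computable_two_pow)
      (Primrec.nat_mul.to_comp.comp (Computable.const 2) hq)) (Computable.const 0)
      (computablePred_eq (Primrec.nat_mod.to_comp.comp hs (Computable.const 2))
        (Computable.const 0))
  · have := (abs_le.1 (happrox k)).2
    have : (0 : ℝ) < (1 / 2) ^ k := by positivity
    rw [hvalue]
    exact max_lt hr0 (by linarith)
  · obtain ⟨k, hk⟩ := exists_pow_lt_of_lt_one (by linarith : 0 < (r - w) / 3)
      (by norm_num : (1 / 2 : ℝ) < 1)
    have := (abs_le.1 (happrox k)).1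
    refine ⟨k, ?_⟩
    rw [hvalue]
    exact lt_max_of_lt_right (by linarith)

theorem mem_wedge_div {p q x : ℕ} (hq : 0 < q) :
    x ∈ wedge (p / q) ↔ 0 < offset x ∧ offset x * q < p * (2 * x.sqrt + 1) := by
  have hq' : (0 : ℝ) < q := Nat.cast_pos.2 hq
  refine and_congr_right fun _ => ?_
  rw [div_mul_eq_mul_div, lt_div_iff₀ hq']
  exact_mod_cast Iff.rfl

theorem computablePred_mem_wedge_div {p q : ℕ → ℕ} (hp : Computable p) (hq : Computable q)
    (hq0 : ∀ k, 0 < q k) : ComputablePred fun a : ℕ × ℕ => a.2 ∈ wedge (p a.1 / q a.1) := by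
  have hoffset : Computable fun a : ℕ × ℕ => offset a.2 := computable_offset.comp Computable.snd
  have hwidth : Computable fun a : ℕ × ℕ => 2 * a.2.sqrt + 1 :=
    Computable.succ.comp (Primrec.nat_mul.to_comp.comp (Computable.const 2)
      (Primrec.nat_sqrt.to_comp.comp Computable.snd))
  exact (computablePred_and (computablePred_lt (Computable.const 0) hoffset) (computablePred_lt
    (Primrec.nat_mul.to_comp.comp hoffset (hq.comp Computable.fst))
    (Primrec.nat_mul.to_comp.comp (hp.comp Computable.fst) hwidth))).of_eq
    fun a => (mem_wedge_div (hq0 a.1)).symm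

theorem mem_wedge_partialSups {c : ℕ → ℝ} {k x : ℕ} :
    x ∈ wedge (partialSups c k) ↔ ∃ i < k + 1, x ∈ wedge (c i) := by
  constructor
  · intro hx
    obtain ⟨i, hi, hki⟩ := exists_partialSups_eq c k
    exact ⟨i, Nat.lt_succ_of_le hi, hki ▸ hx⟩
  · rintro ⟨i, hi, hx⟩
    exact wedge_mono (le_partialSups_of_le c (Nat.le_of_lt_succ hi)) hx

/-- An increasing, uniformly computable sequence of sets `carrier k` without squares whose
densities `density k` approximate `r` strictly from below. -/
structure Exhaustion (r : ℝ) where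
  carrier : ℕ → Set ℕ
  density : ℕ → ℝ
  computable : ComputablePred fun p : ℕ × ℕ => p.2 ∈ carrier p.1
  monotone : Monotone carrier
  offset_ne_zero : ∀ {k x}, x ∈ carrier k → offset x ≠ 0
  hasDensity : ∀ k, HasDensity (carrier k) (density k)
  density_lt : ∀ k, density k < r
  exists_lt_density : ∀ w < r, ∃ k, w < density k

theorem IsLeftCEReal.exists_exhaustion {r : ℝ} (hr : IsLeftCEReal r) (hr1 : r ≤ 1) :
    Nonempty (Exhaustion r) := by
  obtain ⟨p, q, hp, hq, hq0, hlt, hdense⟩ := hr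
  let c : ℕ → ℝ := fun k => p k / q k
  have hsup_lt : ∀ k, partialSups c k < r := fun k => by
    obtain ⟨i, -, hki⟩ := exists_partialSups_eq c k
    exact hki ▸ hlt i
  have hsup_nonneg : ∀ k, 0 ≤ partialSups c k := fun k =>
    (by positivity : (0 : ℝ) ≤ p k / q k).trans (le_partialSups c k)
  have hcomp : ComputablePred fun a : ℕ × ℕ => ∃ i < a.1 + 1, a.2 ∈ wedge (c i) :=
    computablePred_exists_lt (R := fun a i => a.2 ∈ wedge (c i))
      (computablePred_comp (computablePred_mem_wedge_div hp hq hq0)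
        (Computable.snd.pair (Computable.snd.comp Computable.fst)))
      (Computable.succ.comp Computable.fst)
  exact ⟨{
    carrier := fun k => wedge (partialSups c k)
    density := partialSups c
    computable := hcomp.of_eq fun _ => mem_wedge_partialSups.symm
    monotone := fun i k hik => wedge_mono ((partialSups c).monotone hik)
    offset_ne_zero := fun hx => hx.1.ne'
    hasDensity := fun k => hasDensity_wedge (hsup_nonneg k) ((hsup_lt k).le.trans hr1)
    density_lt := hsup_lt
    exists_lt_density := fun w hw =>
      (hdense w hw).imp fun k hk => hk.trans_le (le_partialSups c k) }⟩

/-! ### Blocks -/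

/-- The left end of the block of index `n`. The exponent `n * n` makes each block much longer than
all that precedes it. -/
def blockStart (n : ℕ) : ℕ := 2 ^ (n * n)

theorem blockStart_mono : Monotone blockStart := fun _ _ h =>
  Nat.pow_le_pow_right two_pos (Nat.mul_le_mul h h)

theorem le_blockStart (n : ℕ) : n ≤ blockStart n :=
  (Nat.le_mul_self n).trans Nat.lt_two_pow_self.le

theorem computable_blockStart : Computable blockStart :=
  computable_two_pow.comp (Primrec.nat_mul.to_comp.comp Computable.id Computable.id)

theorem tendsto_blockStart_div_blockStart_succ :
    Tendsto (fun n => (blockStart n : ℝ) / blockStart (n + 1)) atTop (𝓝 0) := by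
  refine squeeze_zero (fun n => by positivity) (fun n => ?_)
    (tendsto_pow_atTop_nhds_zero_of_lt_one (r := (1 / 2 : ℝ)) (by norm_num) (by norm_num))
  have hle : blockStart n * 2 ^ n ≤ blockStart (n + 1) := by
    rw [blockStart, blockStart, ← pow_add]
    exact Nat.pow_le_pow_right two_pos (by linarith)
  have hpos : (0 : ℝ) < blockStart (n + 1) := Nat.cast_pos.2 (Nat.two_pow_pos _)
  rw [div_le_iff₀ hpos, one_div, inv_pow, ← div_eq_inv_mul, le_div_iff₀ (by positivity)]
  exact_mod_cast hle

theorem exists_lt_blockStart_succ (x : ℕ) : ∃ n, x < blockStart (n + 1) :=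
  ⟨x, le_blockStart (x + 1)⟩

/-- The index `n` of the block `[blockStart n, blockStart (n + 1))` that contains `x`; the number
`0` is assigned to block `0`. -/
def block (x : ℕ) : ℕ := Nat.find (exists_lt_blockStart_succ x)

theorem lt_blockStart_succ_block (x : ℕ) : x < blockStart (block x + 1) :=
  Nat.find_spec (exists_lt_blockStart_succ x)

theorem block_eq {n x : ℕ} (h₁ : blockStart n ≤ x) (h₂ : x < blockStart (n + 1)) : block x = n :=
  (Nat.find_eq_iff _).2 ⟨h₂, fun _ hm => ((blockStart_mono hm).trans h₁).not_gt⟩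

theorem computable_block : Computable block :=
  Computable.find (P := fun x n => x < blockStart (n + 1)) (computablePred_lt Computable.fst
    (computable_blockStart.comp (Computable.succ.comp Computable.snd))) exists_lt_blockStart_succ

/-- Below the end of a block, the part preceding the block is negligible. -/
theorem lowerDensity_le_of_frequently_block_subset {X Y : Set ℕ} {ρ : ℝ} (hY : HasDensity Y ρ)
    (h : ∃ᶠ n in atTop, ∀ x ∈ X, block x = n → x ∈ Y) : lowerDensity X ≤ ρ := by
  have hend : Tendsto (fun n => blockStart (n + 1)) atTop atTop :=
    tendsto_atTop_mono (fun n => n.le_succ.trans (le_blockStart _)) tendsto_id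
  have hbound : Tendsto (fun n => densityBelow Y (blockStart (n + 1)) +
      (blockStart n : ℝ) / blockStart (n + 1)) atTop (𝓝 ρ) := by
    simpa using (hY.comp hend).add tendsto_blockStart_div_blockStart_succ
  exact lowerDensity_le_of_frequently_le hend hbound (h.mono fun n hn =>
    densityBelow_le_add fun x hx h₁ h₂ => hn x hx (block_eq h₁ h₂))

/-- The requirement to which the block of `x` is assigned. -/
def requirement (x : ℕ) : ℕ := (block x).unpair.1

/-- The number whose enumeration permits `x` to be enumerated. -/
def permit (x : ℕ) : ℕ := (block x).unpair.2

theorem computable_requirement : Computable requirement :=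
  Computable.fst.comp (Computable.unpair.comp computable_block)

theorem computable_permit : Computable permit :=
  Computable.snd.comp (Computable.unpair.comp computable_block)

theorem requirement_of_block_eq {e m x : ℕ} (h : block x = Nat.pair e m) : requirement x = e := by
  simp [requirement, h]

theorem permit_of_block_eq {e m x : ℕ} (h : block x = Nat.pair e m) : permit x = m := by
  simp [permit, h]

/-! ### Permitting -/

/-- The value that requirement `e` assigns to its block `Nat.pair e (b s)` is known at stage `s`,
the stage at which `b s` is enumerated. -/
def Ready (b : ℕ → ℕ) (e s : ℕ) : Prop :=
  (approx (List ℕ) e (Nat.pair e (b s)) s).isSome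

/-- Requirement `e` succeeds at stage `s`: it is ready, and `b s` exceeds every number at which it
was ready before. Waiting for a record makes the stage of a success computable from a bound on the
number enumerated there. -/
def Success (b : ℕ → ℕ) (e s : ℕ) : Prop :=
  Ready b e s ∧ ∀ t < s, Ready b e t → b t < b s

/-- The numbers enumerated when the requirements succeed: at a success of requirement `e` at stage
`s`, these are the entries in block `Nat.pair e (b s)` of the list it assigns to that block. -/
def followed (b : ℕ → ℕ) : Set ℕ :=
  {x | ∃ s, b s = permit x ∧ Success b (requirement x) s ∧
    ∃ l ∈ approx (List ℕ) (requirement x) (block x) s, x ∈ l}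

section Permitting

variable {b : ℕ → ℕ} {e : ℕ}

theorem computablePred_ready (hb : Computable b) : ComputablePred fun p : ℕ × ℕ =>
    Ready b p.1 p.2 :=
  computablePred_isSome (computable_approx Computable.fst (Primrec₂.natPair.to_comp.comp
    Computable.fst (hb.comp Computable.snd)) Computable.snd)

theorem computablePred_success (hb : Computable b) : ComputablePred fun p : ℕ × ℕ =>
    Success b p.1 p.2 := by
  have hearlier : Computable fun a : (ℕ × ℕ) × ℕ => (a.1.1, a.2) :=
    (Computable.fst.comp Computable.fst).pair Computable.snd
  have hrecord : ComputablePred fun a : (ℕ × ℕ) × ℕ => Ready b a.1.1 a.2 → b a.2 < b a.1.2 :=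
    (computablePred_or (computablePred_comp (computablePred_ready hb) hearlier).not
      (computablePred_lt (hb.comp Computable.snd)
        (hb.comp (Computable.snd.comp Computable.fst)))).of_eq fun _ => imp_iff_not_or.symm
  exact computablePred_and (computablePred_ready hb)
    (computablePred_forall_lt (R := fun p t => Ready b p.1 t → b t < b p.2) hrecord
      Computable.snd)

theorem exists_success_gt (h : ∀ K, ∃ s, Ready b e s ∧ K < b s) (K : ℕ) :
    ∃ s, Success b e s ∧ K < b s := by
  classical
  obtain ⟨hready, hK⟩ := Nat.find_spec (h K)
  refine ⟨Nat.find (h K), ⟨hready, fun t ht htr => ?_⟩, hK⟩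
  exact (not_lt.1 fun hKt => Nat.find_min (h K) ht ⟨htr, hKt⟩).trans_lt hK

theorem Success.le_of_le {s t : ℕ} (hs : Success b e s) (ht : Ready b e t) (hst : b s ≤ b t) :
    s ≤ t :=
  not_lt.1 fun h => (hs.2 t h ht).not_ge hst

/-- Otherwise `e` is not ready when large numbers are enumerated, so that these appear before the
stage at which the value of `e` on their block converges, and `range b` is computable. -/
theorem exists_ready_gt (hb : Computable b) (hrange : ¬ ComputablePred (· ∈ Set.range b))
    (he : ∀ᶠ m in atTop, ∃ s, (approx (List ℕ) e (Nat.pair e m) s).isSome) (K : ℕ) :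
    ∃ s, Ready b e s ∧ K < b s := by
  classical
  by_contra! hbounded
  obtain ⟨m₀, hm₀⟩ := eventually_atTop.1 he
  have hstage : ∀ m, ∃ s, m < m₀ ∨ (approx (List ℕ) e (Nat.pair e m) s).isSome := fun m => by
    rcases lt_or_ge m m₀ with h | h
    · exact ⟨0, .inl h⟩
    · exact (hm₀ m h).imp fun _ => .inr
  have hcomp : Computable fun m => Nat.find (hstage m) :=
    Computable.find (computablePred_or (computablePred_lt Computable.fst (Computable.const m₀))
      (computablePred_isSome (computable_approx (Computable.const e)
        (Primrec₂.natPair.to_comp.comp (Computable.const e) Computable.fst) Computable.snd))) hstage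
  refine hrange (computablePred_of_eventually_iff (computablePred_exists_lt
    (R := fun m s => b s = m) (computablePred_eq (hb.comp Computable.snd) Computable.fst) hcomp) ?_)
  filter_upwards [eventually_gt_atTop K, eventually_ge_atTop m₀] with m hK hm
  refine ⟨?_, fun ⟨s, _, hs⟩ => ⟨s, hs⟩⟩
  rintro ⟨s, rfl⟩
  refine ⟨s, not_le.1 fun hle => hK.not_ge (hbounded s ?_), rfl⟩
  obtain ⟨l, hl⟩ := Option.isSome_iff_exists.1
    ((Nat.find_spec (hstage (b s))).resolve_left hm.not_gt)
  exact Option.isSome_iff_exists.2 ⟨l, approx_mono hle hl⟩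

theorem exists_computable_success_bound (hb : Computable b) (hinj : b.Injective) (e : ℕ) :
    ∃ f : ℕ → ℕ, Computable f ∧ ∀ s, Success b e s → s < f (b s) := by
  classical
  by_cases h : ∀ K, ∃ s, Ready b e s ∧ K ≤ b s
  · refine ⟨fun m => Nat.find (h m) + 1, Computable.succ.comp (Computable.find
      (computablePred_and (computablePred_comp (computablePred_ready hb)
        ((Computable.const e).pair Computable.snd))
        (computablePred_le Computable.fst (hb.comp Computable.snd))) h), fun s hs => ?_⟩
    obtain ⟨hready, hle⟩ := Nat.find_spec (h (b s))
    exact Nat.lt_succ_of_le (hs.le_of_le hready hle)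
  · push Not at h
    obtain ⟨K, hK⟩ := h
    obtain ⟨N, hN⟩ := eventually_atTop.1 (hinj.nat_tendsto_atTop.eventually_ge_atTop K)
    exact ⟨fun _ => N, Computable.const N, fun s hs => not_le.1 fun hle =>
      (hK s hs.1).not_ge (hN s hle)⟩

theorem computablePred_followed_stage (hb : Computable b) : ComputablePred fun p : ℕ × ℕ =>
    Success b (requirement p.1) p.2 ∧
      ∃ l ∈ approx (List ℕ) (requirement p.1) (block p.1) p.2, p.1 ∈ l := by
  have hreq : Computable fun p : ℕ × ℕ => requirement p.1 :=
    computable_requirement.comp Computable.fst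
  have hlist : Computable fun p : ℕ × ℕ =>
      (approx (List ℕ) (requirement p.1) (block p.1) p.2).getD [] :=
    Computable.option_getD (computable_approx hreq (computable_block.comp Computable.fst)
      Computable.snd) (Computable.const [])
  refine computablePred_and
    (computablePred_comp (computablePred_success hb) (hreq.pair Computable.snd))
    ((computablePred_list_mem Computable.fst hlist).of_eq fun p => ?_)
  cases approx (List ℕ) (requirement p.1) (block p.1) p.2 <;> simp

theorem computablePred_mem_followed_of_requirement (hb : Computable b) (hinj : b.Injective)
    (e : ℕ) : ComputablePred fun x => requirement x = e ∧ x ∈ followed b := by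
  obtain ⟨f, hf, hfb⟩ := exists_computable_success_bound hb hinj e
  have hbounded := computablePred_exists_lt (R := fun x s => b s = permit x ∧
      Success b (requirement x) s ∧
        ∃ l ∈ approx (List ℕ) (requirement x) (block x) s, x ∈ l)
    (computablePred_and (computablePred_eq (hb.comp Computable.snd)
      (computable_permit.comp Computable.fst)) (computablePred_followed_stage hb))
    (hf.comp computable_permit)
  refine (computablePred_and (computablePred_eq computable_requirement (Computable.const e))
    hbounded).of_eq fun x => and_congr_right fun hx => ?_
  refine exists_congr fun s => and_iff_right_of_imp fun ⟨hs, hsucc, _⟩ => ?_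
  exact hs ▸ hfb s (hx ▸ hsucc)

theorem exists_index_followed (hb : Computable b) (hrange : ¬ ComputablePred (· ∈ Set.range b))
    {Φ : ℕ →. List ℕ} (hΦ : Partrec Φ) :
    ∃ e, (∃ᶠ m in atTop, ¬ (Φ (Nat.pair e m)).Dom) ∨
      ∃ᶠ m in atTop, ∃ l ∈ Φ (Nat.pair e m), ∀ x, block x = Nat.pair e m →
        (x ∈ followed b ↔ x ∈ l) := by
  obtain ⟨e, he⟩ := exists_index hΦ
  refine ⟨e, or_iff_not_imp_left.2 fun hdom => frequently_atTop'.2 fun K => ?_⟩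
  have hconv : ∀ᶠ m in atTop, ∃ s, (approx (List ℕ) e (Nat.pair e m) s).isSome := by
    refine (not_frequently.1 hdom).mono fun m hm => ?_
    obtain ⟨l, hl⟩ := Part.dom_iff_mem.1 (not_not.1 hm)
    exact ((he _ l).1 hl).imp fun s hs => Option.isSome_iff_exists.2 ⟨l, hs⟩
  obtain ⟨s, hs, hK⟩ := exists_success_gt (exists_ready_gt hb hrange hconv) K
  obtain ⟨l, hl⟩ := Option.isSome_iff_exists.1 hs.1
  have hlΦ : l ∈ Φ (Nat.pair e (b s)) := (he _ l).2 ⟨s, hl⟩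
  refine ⟨b s, hK, l, hlΦ, fun x hx => ?_⟩
  simp only [followed, Set.mem_ofPred_eq, requirement_of_block_eq hx, permit_of_block_eq hx, hx]
  constructor
  · rintro ⟨t, -, -, l', hl', hxl'⟩
    exact Part.mem_unique ((he _ l').2 ⟨t, hl'⟩) hlΦ ▸ hxl'
  · exact fun hxl => ⟨s, rfl, hs, l, hl, hxl⟩

end Permitting

/-! ### The diagonal set -/

section Diagonalization

variable {r : ℝ} {b : ℕ → ℕ} (D : Exhaustion r)

/-- The numbers at which the diagonal set may follow the requirement in charge: they are neither
squares nor in the set reserved against this requirement. -/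
def IsFree (x : ℕ) : Prop := offset x ≠ 0 ∧ x ∉ D.carrier (requirement x)

/-- The set that codes `range b` on the squares and follows the requirements at free numbers. -/
def diagSet (b : ℕ → ℕ) : Set ℕ :=
  {x | (offset x = 0 ∧ x.sqrt ∈ Set.range b) ∨ (IsFree D x ∧ x ∈ followed b)}

theorem Exhaustion.computablePred_carrier (k : ℕ) : ComputablePred (· ∈ D.carrier k) :=
  computablePred_comp (p := fun p : ℕ × ℕ => p.2 ∈ D.carrier p.1) D.computable
    ((Computable.const k).pair Computable.id)

theorem computablePred_offset_eq_zero : ComputablePred fun x => offset x = 0 :=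
  computablePred_eq computable_offset (Computable.const 0)

theorem computablePred_isFree : ComputablePred (IsFree D) :=
  computablePred_and computablePred_offset_eq_zero.not
    (computablePred_comp D.computable (computable_requirement.pair Computable.id)).not

theorem mem_diagSet_of_isFree {x : ℕ} (hx : IsFree D x) : x ∈ diagSet D b ↔ x ∈ followed b := by
  simp [diagSet, hx, hx.1]

theorem mul_self_mem_diagSet {x : ℕ} : x * x ∈ diagSet D b ↔ x ∈ Set.range b := by
  simp [diagSet, IsFree, offset]

theorem rePred_diagSet_and_setReducible (hb : Computable b) (hinj : b.Injective) :
    REPred (· ∈ diagSet D b) ∧ SetReducible (diagSet D b) (Set.range b) := by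
  let q x := if offset x = 0 then x.sqrt else permit x
  let P x s := offset x = 0 ∨ (IsFree D x ∧ Success b (requirement x) s ∧
    ∃ l ∈ approx (List ℕ) (requirement x) (block x) s, x ∈ l)
  have hq : Computable q :=
    ComputablePred.ite Primrec.nat_sqrt.to_comp computable_permit computablePred_offset_eq_zero
  have hP : ComputablePred fun p : ℕ × ℕ => P p.1 p.2 :=
    computablePred_or (computablePred_comp computablePred_offset_eq_zero Computable.fst)
      (computablePred_and (computablePred_comp (computablePred_isFree D) Computable.fst)
        (computablePred_followed_stage hb))
  have hmem : ∀ x, x ∈ diagSet D b ↔ ∃ s, b s = q x ∧ P x s := fun x => by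
    by_cases hx : offset x = 0
    · simp [diagSet, IsFree, q, P, hx]
    · simp only [diagSet, followed, q, P, hx, Set.mem_ofPred_eq, false_and, false_or, if_false]
      grind
  exact ⟨(rePred_exists (computablePred_and (computablePred_eq (hb.comp Computable.snd)
    (hq.comp Computable.fst)) hP)).of_eq fun x => (hmem x).symm,
    setReducible_range_of_stage hb hinj hq hP hmem⟩

theorem degree_diagSet (hb : Computable b) (hinj : b.Injective) :
    degree (diagSet D b) = degree (Set.range b) :=
  degree_eq_of_setReducible (rePred_diagSet_and_setReducible D hb hinj).2
    (setReducible_of_manyOne (Primrec.nat_mul.to_comp.comp Computable.id Computable.id)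
      fun _ => (mul_self_mem_diagSet D).symm)

/-- By monotonicity only the requirements below `k` act in `D.carrier k`. -/
theorem computablePred_diagSet_inter (hb : Computable b) (hinj : b.Injective) (k : ℕ) :
    ComputablePred (· ∈ diagSet D b ∩ D.carrier k) := by
  refine (computablePred_and
    (computablePred_and (D.computablePred_carrier k) (computablePred_isFree D))
    (computablePred_lt_and (computablePred_mem_followed_of_requirement hb hinj) k)).of_eq
    fun x => ?_
  have hsquare : x ∈ D.carrier k → offset x ≠ 0 := D.offset_ne_zero
  have hlt : x ∈ D.carrier k → IsFree D x → requirement x < k := fun hxk hx =>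
    not_le.1 fun hle => hx.2 (D.monotone hle hxk)
  simp only [diagSet, Set.mem_inter_iff, Set.mem_ofPred_eq]
  tauto

/-- On the given blocks `X` is contained in the squares together with `D.carrier e`, a set of
density less than `r`. -/
theorem lowerDensity_lt_of_frequently_not_isFree {X : Set ℕ} {e : ℕ}
    (h : ∃ᶠ m in atTop, ∀ x ∈ X, block x = Nat.pair e m → ¬ IsFree D x) :
    lowerDensity X < r := by
  have hdensity : HasDensity ({x | offset x = 0} ∪ D.carrier e) (D.density e) := by
    refine tendsto_of_tendsto_of_tendsto_of_le_of_le (D.hasDensity e)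
      (by simpa using hasDensity_offset_eq_zero.add (D.hasDensity e))
      (densityBelow_mono Set.subset_union_right) (densityBelow_union_le _ _)
  have hpair : Tendsto (Nat.pair e) atTop atTop :=
    tendsto_atTop_mono (Nat.right_le_pair e) tendsto_id
  refine (lowerDensity_le_of_frequently_block_subset hdensity
    (hpair.frequently (h.mono fun m hm x hx hxm => ?_))).trans_lt (D.density_lt e)
  have hreq := requirement_of_block_eq hxm
  by_contra hnot
  simp only [Set.mem_union, Set.mem_ofPred_eq, not_or] at hnot
  exact hm x hx hxm ⟨hnot.1, hreq ▸ hnot.2⟩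

theorem lowerDensity_lt_of_diagonalization (hb : Computable b)
    (hrange : ¬ ComputablePred (· ∈ Set.range b)) {X : Set ℕ} {Φ : ℕ →. List ℕ} (hΦ : Partrec Φ)
    (hdiverges : ∀ n, ¬ (Φ n).Dom → ∀ x ∈ X, block x = n → ¬ IsFree D x)
    (hconverges : ∀ n, ∀ l ∈ Φ n,
      (∀ x, block x = n → IsFree D x → (x ∈ diagSet D b ↔ x ∈ l)) →
        ∀ x ∈ X, block x = n → ¬ IsFree D x) :
    lowerDensity X < r := by
  obtain ⟨e, he | he⟩ := exists_index_followed hb hrange hΦ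
  · exact lowerDensity_lt_of_frequently_not_isFree D (he.mono fun m hm => hdiverges _ hm)
  · refine lowerDensity_lt_of_frequently_not_isFree D (e := e) (he.mono fun m hm => ?_)
    obtain ⟨l, hl, hfollow⟩ := hm
    exact hconverges _ l hl fun x hx hfree =>
      (mem_diagSet_of_isFree D hfree).trans (hfollow x hx)

/-- The requirement is to follow the complement of `C`. Its list for block `n` needs an entry for
each `x ∈ C` too, for which it uses a number above the block. -/
theorem lowerDensity_agreement_diagSet_lt (hb : Computable b)
    (hrange : ¬ ComputablePred (· ∈ Set.range b)) {C : Set ℕ} (hC : ComputablePred (· ∈ C)) :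
    lowerDensity (agreement (diagSet D b) C) < r := by
  classical
  let complement n :=
    (List.range (blockStart (n + 1))).map fun x => if x ∈ C then blockStart (n + 1) else x
  have hend : Computable fun n => blockStart (n + 1) := computable_blockStart.comp Computable.succ
  have hentry : Computable fun p : ℕ × ℕ => if p.2 ∈ C then blockStart (p.1 + 1) else p.2 :=
    computable_ite (computablePred_comp hC Computable.snd) (hend.comp Computable.fst)
      Computable.snd
  have hcomplement : Computable complement := computable_table hentry.to₂ hend
  have hmem : ∀ n x, block x = n → (x ∈ complement n ↔ x ∉ C) := by
    rintro _ x rfl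
    have hx := lt_blockStart_succ_block x
    simp only [complement, List.mem_map, List.mem_range]
    grind
  refine lowerDensity_lt_of_diagonalization D hb hrange hcomplement.partrec
    (fun n hn => (hn trivial).elim) fun n l hl hfollow x hx hxn hfree => ?_
  obtain rfl := Part.mem_some_iff.1 hl
  have := hfollow x hxn hfree
  rw [hmem n x hxn] at this
  exact iff_not_self (hx.symm.trans this)

/-- Dovetailing over pairs of an argument and a stage. -/
theorem exists_partrec_selector {ψ : ℕ →. ℕ} (hψ : Partrec ψ) {P : ℕ → ℕ → Prop}
    (hP : ComputablePred fun p : ℕ × ℕ => P p.1 p.2) :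
    ∃ sel : ℕ →. ℕ × ℕ, Partrec sel ∧ (∀ n, ∀ p ∈ sel n, P n p.1 ∧ p.2 ∈ ψ p.1) ∧
      ∀ n x, P n x → (ψ x).Dom → (sel n).Dom := by
  classical
  obtain ⟨e, he⟩ := exists_index hψ
  let search n (t : ℕ) : Option (ℕ × ℕ) :=
    if P n t.unpair.1 then (approx ℕ e t.unpair.1 t.unpair.2).map (Prod.mk t.unpair.1) else none
  have hfst : Computable fun p : ℕ × ℕ => p.2.unpair.1 :=
    Computable.fst.comp (Computable.unpair.comp Computable.snd)
  have hsnd : Computable fun p : ℕ × ℕ => p.2.unpair.2 :=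
    Computable.snd.comp (Computable.unpair.comp Computable.snd)
  have hfound : Computable fun p : ℕ × ℕ =>
      (approx ℕ e p.2.unpair.1 p.2.unpair.2).map (Prod.mk p.2.unpair.1) :=
    Computable.option_map (computable_approx (Computable.const e) hfst hsnd)
      ((hfst.comp Computable.fst).pair Computable.snd).to₂
  have hsearch : Computable₂ search :=
    (computable_ite (computablePred_comp hP (Computable.fst.pair hfst)) hfound
      (Computable.const none)).to₂
  refine ⟨fun n => Nat.rfindOpt (search n), Partrec.rfindOpt hsearch, fun n p hp => ?_,
    fun n x hx hdom => ?_⟩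
  · obtain ⟨t, ht⟩ := Nat.rfindOpt_spec hp
    obtain ⟨hPt, hsome⟩ : P n t.unpair.1 ∧ p ∈ (approx ℕ e _ _).map (Prod.mk t.unpair.1) := by
      simpa only [search, Option.mem_ite_none_right] using ht
    obtain ⟨v, hv, rfl⟩ := Option.map_eq_some_iff.1 hsome
    exact ⟨hPt, (he _ v).2 ⟨_, hv⟩⟩
  · obtain ⟨v, hv⟩ := Part.dom_iff_mem.1 hdom
    obtain ⟨s, hs⟩ := (he x v).1 hv
    exact Nat.rfindOpt_dom.2 ⟨Nat.pair x s, (x, v), by simpa [search, hx] using hs⟩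

/-- The requirement searches its block for a free number `x` in the domain of `ψ`, and is to follow
`{x}` or `∅`, whichever contradicts `ψ x`. -/
theorem lowerDensity_dom_lt (hb : Computable b) (hrange : ¬ ComputablePred (· ∈ Set.range b))
    {ψ : ℕ →. ℕ} (hψ : Partrec ψ) (hagree : ∀ n, ∀ v ∈ ψ n, v = charFn (diagSet D b) n) :
    lowerDensity ψ.Dom < r := by
  have hP : ComputablePred fun p : ℕ × ℕ => block p.2 = p.1 ∧ IsFree D p.2 :=
    computablePred_and (computablePred_eq (computable_block.comp Computable.snd) Computable.fst)
      (computablePred_comp (computablePred_isFree D) Computable.snd)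
  obtain ⟨sel, hsel, hspec, hdom⟩ :=
    exists_partrec_selector hψ (P := fun n x => block x = n ∧ IsFree D x) hP
  let flip (p : ℕ × ℕ) : List ℕ := if p.2 = 0 then [p.1] else []
  have hflip : Computable flip :=
    computable_ite (computablePred_eq Computable.snd (Computable.const 0))
      (Computable.list_cons.comp Computable.fst (Computable.const [])) (Computable.const [])
  have hΦ : Partrec fun n => (sel n).map flip := hsel.map (hflip.comp Computable.snd).to₂
  refine lowerDensity_lt_of_diagonalization D hb hrange hΦ (fun n hn x hx hxn hfree => ?_)
    fun n l hl hfollow => ?_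
  · exact hn (hdom n x ⟨hxn, hfree⟩ hx)
  · obtain ⟨⟨x, v⟩, hxv, rfl⟩ := (Part.mem_map_iff _).1 hl
    obtain ⟨⟨hxn, hfree⟩, hv⟩ := hspec n _ hxv
    obtain rfl : v = charFn (diagSet D b) x := hagree x v hv
    have hcontra := hfollow x hxn hfree
    by_cases hx : x ∈ diagSet D b <;>
      simp [flip, hx, charFn_of_mem, charFn_of_notMem] at hcontra

end Diagonalization

/-! ### The computability bounds -/

section Bounds

variable {A D : Set ℕ}

theorem partiallyComputableAt_of_inter (hD : ComputablePred (· ∈ D))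
    (hAD : ComputablePred (· ∈ A ∩ D)) : PartiallyComputableAt A (lowerDensity D) := by
  classical
  let φ x : Part ℕ := cond (decide (x ∈ D)) (Part.some (charFn (A ∩ D) x)) Part.none
  have hφ : Partrec φ := Partrec.cond hD.decide (computable_charFn hAD).partrec Partrec.none
  refine ⟨φ, hφ, fun n v hv => ?_, lowerDensity_mono fun x hx => ?_⟩
  · by_cases hn : n ∈ D
    · have hv' : v = charFn (A ∩ D) n := by simpa [φ, hn] using hv
      exact hv'.trans (charFn_eq_charFn (and_iff_left hn))
    · simp [φ, hn] at hv
  · change (φ x).Dom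
    simp [φ, hx]

theorem coarselyComputableAt_of_inter (hAD : ComputablePred (· ∈ A ∩ D)) :
    CoarselyComputableAt A (lowerDensity D) :=
  ⟨A ∩ D, hAD, lowerDensity_mono fun x hx => by simp [agreement, hx]⟩

end Bounds

theorem Exhaustion.sSup_eq {r : ℝ} (D : Exhaustion r) {p : ℝ → Prop} (hlt : ∀ t, p t → t < r)
    (hp : ∀ k, p (lowerDensity (D.carrier k))) : sSup {t | t ∈ Set.Icc (0 : ℝ) 1 ∧ p t} = r := by
  have hmem : ∀ k, D.density k ∈ {t | t ∈ Set.Icc (0 : ℝ) 1 ∧ p t} := fun k =>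
    ⟨⟨(D.hasDensity k).nonneg, (D.hasDensity k).le_one⟩,
      (D.hasDensity k).lowerDensity_eq ▸ hp k⟩
  exact csSup_eq_of_forall_le_of_forall_lt_exists_gt ⟨_, hmem 0⟩ (fun t ht => (hlt t ht.2).le)
    fun w hw => let ⟨k, hk⟩ := D.exists_lt_density w hw; ⟨_, hmem k, hk⟩

theorem theorem3p6_general (a : TuringDegree) (ha : IsCEDegree a) (ha0 : a ≠ zeroDegree) (r : ℝ)
    (hr : IsLeftCEReal r) (hr1 : r ≤ 1) :
    ∃ A : Set ℕ, REPred (fun n => n ∈ A) ∧ degree A = a ∧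
      partialBound A = r ∧ coarseBound A = r ∧ ¬ CoarselyComputableAt A r := by
  obtain ⟨B, hB, rfl⟩ := ha
  have hBnc : ¬ ComputablePred (· ∈ B) := mt degree_eq_zeroDegree ha0
  obtain ⟨b, hb, hinj, rfl⟩ :=
    exists_injective_computable_range_eq hB (mt computablePred_of_finite hBnc)
  obtain ⟨D⟩ := hr.exists_exhaustion hr1
  have hpartial : ∀ t, PartiallyComputableAt (diagSet D b) t → t < r :=
    fun _ ⟨_, hψ, hagree, ht⟩ => ht.trans_lt (lowerDensity_dom_lt D hb hBnc hψ hagree)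
  have hcoarse : ∀ t, CoarselyComputableAt (diagSet D b) t → t < r :=
    fun _ ⟨_, hC, ht⟩ => ht.trans_lt (lowerDensity_agreement_diagSet_lt D hb hBnc hC)
  have hinter := computablePred_diagSet_inter D hb hinj
  exact ⟨diagSet D b, (rePred_diagSet_and_setReducible D hb hinj).1, degree_diagSet D hb hinj,
    D.sSup_eq hpartial fun k =>
      partiallyComputableAt_of_inter (D.computablePred_carrier k) (hinter k),
    D.sSup_eq hcoarse fun k => coarselyComputableAt_of_inter (hinter k),
    fun h => (hcoarse r h).false⟩

end CoarseComp

theorem theorem3p6 (a : TuringDegree) (ha : CoarseComp.IsCEDegree a)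
    (ha0 : a ≠ CoarseComp.zeroDegree) (r : ℝ) (hr : CoarseComp.IsComputableReal r)
    (hr0 : 0 < r) (hr1 : r ≤ 1) :
    ∃ A : Set ℕ, REPred (fun n => n ∈ A) ∧ CoarseComp.degree A = a ∧
      CoarseComp.partialBound A = r ∧ CoarseComp.coarseBound A = r ∧
      ¬ CoarseComp.CoarselyComputableAt A r :=
  CoarseComp.theorem3p6_general a ha ha0 r (hr.isLeftCEReal hr0) hr1
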